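/- Let $I\subseteq\mathbb R$ be open, $a:I\to(0,\infty)$ smooth, $k\in\mathbb R$, and let $$g=-\,dt^2+a(t)^2\Big(\frac{dr^2}{1-kr^2}+r^2d\theta^2+r^2\sin^2\theta\,d\varphi^2\Big)$$ be the FLRW metric on the coordinate domain $M=\{(t,r,\theta,\varphi): t\in I,\ r>0,\ kr^2<1,\ 0<\theta<\pi,\ 0<\varphi<2\pi\}$, with index $0$ referring to $t$. Let $\nabla$, $R_{\mu\nu}$, $R$, $G_{\mu\nu}=R_{\mu\nu}-\tfrac12 Rg_{\mu\nu}$ be its Levi-Civita connection, Ricci tensor, scalar curvature and Einstein tensor, with the sign convention $R_{\mu\nu}=\partial_\alpha\Gamma^\alpha_{\mu\nu}-\partial_\nu\Gamma^\alpha_{\mu\alpha}+\Gamma^\alpha_{\alpha\beta}\Gamma^\beta_{\mu\nu}-\Gamma^\alpha_{\nu\beta}\Gamma^\beta_{\mu\alpha}$; put $\Box=\frac1{\sqrt{|g|}}\partial_\mu\big(\sqrt{|g|}\,g^{\mu\nu}\partial_\nu\big)$ and $K_{\mu\nu}=\nabla_\mu\nabla_\nu-g_{\mu\nu}\Box$.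 Let $\Lambda,G\in\mathbb R$ with $G\neq0$, let $(f_n)_{n\ge0}$ be a real sequence, and put $\mathcal F(\Box)=\sum_{n=0}^\infty f_n\Box^n$ (pointwise limit of partial sums). Let $p,q\in\mathbb Z$, and if $p<0$ or $q<0$ assume that $R$ vanishes nowhere on $M$. Put $$\Phi=pR^{p-1}\mathcal F(\Box)R^q+qR^{q-1}\mathcal F(\Box)R^p .$$ Say that one of the equations below holds on $M$ if all its terms are meaningful on $M$ (the series $\mathcal F(\Box)R^p$ and $\mathcal F(\Box)R^q$ and the series $\sum_{n\ge1}$ occurring in the equation converge pointwise, and $\Phi$ is twice continuously differentiable) and the equation is satisfied at every point of $M$. Then the equations of motion $$\frac{G_{\mu\nu}+\Lambda g_{\mu\nu}}{16\pi G}-\frac12g_{\mu\nu}R^p\mathcal F(\Box)R^q+\big(R_{\mu\nu}\Phi-K_{\mu\nu}\Phi\big)+\frac12\sum_{n=1}^\infty f_n\sum_{l=0}^{n-1}\Big(g_{\mu\nu}\,\partial^\alpha\Box^lR^p\,\partial_\alpha\Box^{n-1-l}R^q-2\,\partial_\mu\Box^lR^p\,\partial_\nu\Box^{n-1-l}R^q+g_{\mu\nu}\,\Box^lR^p\,\Box^{n-l}R^q\Big)=0$$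 hold on $M$ for all $\mu,\nu\in\{0,1,2,3\}$ if and only if the following two equations hold on $M$: the trace equation $$\frac{4\Lambda-R}{16\pi G}-2R^p\mathcal F(\Box)R^q+\big(R\Phi+3\Box\Phi\big)+\sum_{n=1}^\infty f_n\sum_{l=0}^{n-1}\Big(\partial^\mu\Box^lR^p\,\partial_\mu\Box^{n-1-l}R^q+2\,\Box^lR^p\,\Box^{n-l}R^q\Big)=0,$$ and the $00$-equation, that is, the equation of motion with $\mu=\nu=0$. -/

import Mathlib

open Finset SummationFilter
open scoped BigOperators Topology ContDiff

noncomputable section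

namespace NonlocalGravity

/-! Pseudo-Riemannian geometry in a coordinate chart of an `n`-dimensional manifold. Points are
coordinate tuples, and a metric is the matrix field of its components `g μ ν`. -/

/-- The partial derivative `∂_μ u`. -/
def pd {n : ℕ} (μ : Fin n) (u : (Fin n → ℝ) → ℝ) (x : Fin n → ℝ) : ℝ :=
  fderiv ℝ u x (Pi.single μ 1)

/-- The Christoffel symbol `Γ^l_{μν}` of the Levi-Civita connection. -/
def christoffel {n : ℕ} (g : (Fin n → ℝ) → Matrix (Fin n) (Fin n) ℝ) (l μ ν : Fin n)
    (x : Fin n → ℝ) : ℝ :=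
  1 / 2 * ∑ s, (g x)⁻¹ l s *
    (pd μ (fun y => g y s ν) x + pd ν (fun y => g y s μ) x - pd s (fun y => g y μ ν) x)

/-- The Ricci tensor
`R_{μν} = ∂_α Γ^α_{μν} - ∂_ν Γ^α_{μα} + Γ^α_{αβ} Γ^β_{μν} - Γ^α_{νβ} Γ^β_{μα}`. -/
def ricci {n : ℕ} (g : (Fin n → ℝ) → Matrix (Fin n) (Fin n) ℝ) (μ ν : Fin n)
    (x : Fin n → ℝ) : ℝ :=
  ∑ α, pd α (christoffel g α μ ν) x - ∑ α, pd ν (christoffel g α μ α) x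
    + ∑ α, ∑ β, (christoffel g α α β x * christoffel g β μ ν x
      - christoffel g α ν β x * christoffel g β μ α x)

/-- The scalar curvature `R = g^{μν} R_{μν}`. -/
def scalarCurv {n : ℕ} (g : (Fin n → ℝ) → Matrix (Fin n) (Fin n) ℝ) (x : Fin n → ℝ) : ℝ :=
  ∑ μ, ∑ ν, (g x)⁻¹ μ ν * ricci g μ ν x

/-- The Einstein tensor `G_{μν} = R_{μν} - (1/2) R g_{μν}`. -/
def einstein {n : ℕ} (g : (Fin n → ℝ) → Matrix (Fin n) (Fin n) ℝ) (μ ν : Fin n)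
    (x : Fin n → ℝ) : ℝ :=
  ricci g μ ν x - 1 / 2 * scalarCurv g x * g x μ ν

/-- The d'Alembert operator `□ u = |g|^{-1/2} ∂_μ (|g|^{1/2} g^{μν} ∂_ν u)`. -/
def box {n : ℕ} (g : (Fin n → ℝ) → Matrix (Fin n) (Fin n) ℝ) (u : (Fin n → ℝ) → ℝ)
    (x : Fin n → ℝ) : ℝ :=
  1 / √|(g x).det| * ∑ μ, pd μ (fun y => √|(g y).det| * ∑ ν, (g y)⁻¹ μ ν * pd ν u y) x

/-- The iterates `□^m u`. -/
def boxPow {n : ℕ} (g : (Fin n → ℝ) → Matrix (Fin n) (Fin n) ℝ) (m : ℕ)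
    (u : (Fin n → ℝ) → ℝ) : (Fin n → ℝ) → ℝ :=
  (box g)^[m] u

/-- The second covariant derivative `∇_μ ∇_ν u = ∂_μ ∂_ν u - Γ^l_{μν} ∂_l u` of a scalar. -/
def hess {n : ℕ} (g : (Fin n → ℝ) → Matrix (Fin n) (Fin n) ℝ) (μ ν : Fin n)
    (u : (Fin n → ℝ) → ℝ) (x : Fin n → ℝ) : ℝ :=
  pd μ (pd ν u) x - ∑ l, christoffel g l μ ν x * pd l u x

/-- `K_{μν} u = ∇_μ ∇_ν u - g_{μν} □ u`. -/
def opK {n : ℕ} (g : (Fin n → ℝ) → Matrix (Fin n) (Fin n) ℝ) (μ ν : Fin n)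
    (u : (Fin n → ℝ) → ℝ) (x : Fin n → ℝ) : ℝ :=
  hess g μ ν u x - g x μ ν * box g u x

/-- `∂^α u ∂_α v = g^{αβ} ∂_β u ∂_α v`. -/
def gradProd {n : ℕ} (g : (Fin n → ℝ) → Matrix (Fin n) (Fin n) ℝ) (u v : (Fin n → ℝ) → ℝ)
    (x : Fin n → ℝ) : ℝ :=
  ∑ α, ∑ β, (g x)⁻¹ α β * pd β u x * pd α v x

/-! The nonlocal terms. Infinite series of reals are limits of their partial sums (this is the
summation filter `conditional ℕ`). -/

/-- The integer power `R^p` of the scalar curvature. -/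
def curvPow {n : ℕ} (g : (Fin n → ℝ) → Matrix (Fin n) (Fin n) ℝ) (p : ℤ)
    (x : Fin n → ℝ) : ℝ :=
  scalarCurv g x ^ p

/-- `F(□) u = ∑_{m ≥ 0} f_m □^m u`. -/
def nonlocalOp {n : ℕ} (g : (Fin n → ℝ) → Matrix (Fin n) (Fin n) ℝ) (f : ℕ → ℝ)
    (u : (Fin n → ℝ) → ℝ) (x : Fin n → ℝ) : ℝ :=
  ∑'[conditional ℕ] m, f m * boxPow g m u x

/-- `Φ = p R^{p-1} F(□) R^q + q R^{q-1} F(□) R^p`. -/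
def Phi {n : ℕ} (g : (Fin n → ℝ) → Matrix (Fin n) (Fin n) ℝ) (f : ℕ → ℝ) (p q : ℤ)
    (x : Fin n → ℝ) : ℝ :=
  p * curvPow g (p - 1) x * nonlocalOp g f (curvPow g q) x
    + q * curvPow g (q - 1) x * nonlocalOp g f (curvPow g p) x

/-- On the region `U`, the series `F(□) R^p` and `F(□) R^q` converge pointwise and `Φ` is twice
continuously differentiable, so that `K_{μν} Φ` and `□ Φ` make sense. -/
structure NonlocalTermsDefined {n : ℕ} (g : (Fin n → ℝ) → Matrix (Fin n) (Fin n) ℝ)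
    (f : ℕ → ℝ) (p q : ℤ) (U : Set (Fin n → ℝ)) : Prop where
  summable_left : ∀ x ∈ U, Summable (fun m => f m * boxPow g m (curvPow g p) x) (conditional ℕ)
  summable_right : ∀ x ∈ U, Summable (fun m => f m * boxPow g m (curvPow g q) x) (conditional ℕ)
  contDiffOn_Phi : ContDiffOn ℝ 2 (Phi g f p q) U

/-- The term with index `m + 1` (`m = 0, 1, 2, …`) of the series in the `μν` equation of motion:
`f_{m+1} ∑_{l=0}^{m} (g_{μν} ∂^α □^l R^p ∂_α □^{m-l} R^q - 2 ∂_μ □^l R^p ∂_ν □^{m-l} R^q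
  + g_{μν} □^l R^p □^{m+1-l} R^q)`. -/
def eomTerm {n : ℕ} (g : (Fin n → ℝ) → Matrix (Fin n) (Fin n) ℝ) (f : ℕ → ℝ) (p q : ℤ)
    (μ ν : Fin n) (x : Fin n → ℝ) (m : ℕ) : ℝ :=
  f (m + 1) * ∑ l ∈ range (m + 1),
    (g x μ ν * gradProd g (boxPow g l (curvPow g p)) (boxPow g (m - l) (curvPow g q)) x
      - 2 * pd μ (boxPow g l (curvPow g p)) x * pd ν (boxPow g (m - l) (curvPow g q)) x
      + g x μ ν * boxPow g l (curvPow g p) x * boxPow g (m + 1 - l) (curvPow g q) x)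

/-- The `μν` component of the equations of motion holds on `U`: all terms are meaningful (the series
converge, `Φ` is `C²`) and the left-hand side vanishes. -/
def EOMComponent {n : ℕ} (g : (Fin n → ℝ) → Matrix (Fin n) (Fin n) ℝ) (f : ℕ → ℝ) (p q : ℤ)
    (G Λ : ℝ) (U : Set (Fin n → ℝ)) (μ ν : Fin n) : Prop :=
  NonlocalTermsDefined g f p q U ∧ ∀ x ∈ U,
    Summable (eomTerm g f p q μ ν x) (conditional ℕ) ∧
    1 / (16 * Real.pi * G) * (einstein g μ ν x + Λ * g x μ ν)
      - 1 / 2 * g x μ ν * curvPow g p x * nonlocalOp g f (curvPow g q) x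
      + (ricci g μ ν x * Phi g f p q x - opK g μ ν (Phi g f p q) x)
      + 1 / 2 * ∑'[conditional ℕ] m, eomTerm g f p q μ ν x m = 0

/-- The equations of motion hold on `U`: all components do. -/
def EOM {n : ℕ} (g : (Fin n → ℝ) → Matrix (Fin n) (Fin n) ℝ) (f : ℕ → ℝ) (p q : ℤ)
    (G Λ : ℝ) (U : Set (Fin n → ℝ)) : Prop :=
  ∀ μ ν : Fin n, EOMComponent g f p q G Λ U μ ν

/-- The term with index `m + 1` (`m = 0, 1, 2, …`) of the series in the trace equation:
`f_{m+1} ∑_{l=0}^{m} (∂^μ □^l R^p ∂_μ □^{m-l} R^q + 2 □^l R^p □^{m+1-l} R^q)`. -/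
def traceTerm {n : ℕ} (g : (Fin n → ℝ) → Matrix (Fin n) (Fin n) ℝ) (f : ℕ → ℝ) (p q : ℤ)
    (x : Fin n → ℝ) (m : ℕ) : ℝ :=
  f (m + 1) * ∑ l ∈ range (m + 1),
    (gradProd g (boxPow g l (curvPow g p)) (boxPow g (m - l) (curvPow g q)) x
      + 2 * boxPow g l (curvPow g p) x * boxPow g (m + 1 - l) (curvPow g q) x)

/-- The trace equation (in dimension four) holds on `U`, with the same requirement that all its terms
are meaningful. -/
def TraceEquation (g : (Fin 4 → ℝ) → Matrix (Fin 4) (Fin 4) ℝ) (f : ℕ → ℝ) (p q : ℤ)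
    (G Λ : ℝ) (U : Set (Fin 4 → ℝ)) : Prop :=
  NonlocalTermsDefined g f p q U ∧ ∀ x ∈ U,
    Summable (traceTerm g f p q x) (conditional ℕ) ∧
    1 / (16 * Real.pi * G) * (4 * Λ - scalarCurv g x)
      - 2 * curvPow g p x * nonlocalOp g f (curvPow g q) x
      + (scalarCurv g x * Phi g f p q x + 3 * box g (Phi g f p q) x)
      + ∑'[conditional ℕ] m, traceTerm g f p q x m = 0

/-- The FLRW metric `-dt² + a(t)² (dr²/(1 - k r²) + r² dθ² + r² sin²θ dφ²)` in the coordinates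
`x 0 = t`, `x 1 = r`, `x 2 = θ`, `x 3 = φ`. -/
def flrw (a : ℝ → ℝ) (k : ℝ) (x : Fin 4 → ℝ) : Matrix (Fin 4) (Fin 4) ℝ :=
  Matrix.diagonal ![-1, a (x 0) ^ 2 / (1 - k * x 1 ^ 2), a (x 0) ^ 2 * x 1 ^ 2,
    a (x 0) ^ 2 * x 1 ^ 2 * Real.sin (x 2) ^ 2]

/-- The region covered by the coordinates `(t, r, θ, φ)`, for times `t ∈ I`. -/
def flrwChart (I : Set ℝ) (k : ℝ) : Set (Fin 4 → ℝ) :=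
  {x | x 0 ∈ I ∧ 0 < x 1 ∧ k * x 1 ^ 2 < 1 ∧ x 2 ∈ Set.Ioo 0 Real.pi ∧
    x 3 ∈ Set.Ioo 0 (2 * Real.pi)}

end NonlocalGravity

end

noncomputable section

namespace NonlocalGravity

/-! Partial derivatives. -/

/-! The symmetry of the FLRW metric does all the work, and no Bianchi identity or conservation law
is needed. The scalar curvature depends on time alone, and `□` preserves functions of time, so all
iterates `□^l R^p`, the sums `F(□) R^p` and `Φ` are functions of `t`. Every tensor in the equations
of motion is then diagonal, of the form `g_{μμ}` times a function of time, and the three spatial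
functions coincide (`ricci_flrw`, `opK_time`, `eomTerm_flrw`). The off-diagonal equations are
therefore vacuous, and two scalar equations remain, `E₀ = 0` and `E₁ = 0`. The trace equation is `E₀
+ 3 E₁ = 0`, so with `E₀ = 0` it gives `E₁ = 0`.

Convergence has to be transferred too. With kinetic and potential parts `K` and `P`, the series are
those of `P + K` in `E₀`, of `P - K` in `E₁` and of `2P - K` in the trace. Any two of these
determine the third linearly, so convergence and values follow the same algebra as the equations
(`eomComponent_flrw_self`, `traceEquation_flrw`). -/

lemma pd_congr {n : ℕ} {u v : (Fin n → ℝ) → ℝ} {x : Fin n → ℝ} (h : u =ᶠ[𝓝 x] v) (μ : Fin n) :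
    pd μ u x = pd μ v x := by
  unfold pd
  rw [h.fderiv_eq]

lemma pd_congr_on {n : ℕ} {u v : (Fin n → ℝ) → ℝ} {U : Set (Fin n → ℝ)} (hU : IsOpen U)
    (h : ∀ y ∈ U, u y = v y) {x : Fin n → ℝ} (hx : x ∈ U) (μ : Fin n) :
    pd μ u x = pd μ v x :=
  pd_congr (Filter.eventuallyEq_of_mem (hU.mem_nhds hx) h) μ

@[simp] lemma pd_const {n : ℕ} (μ : Fin n) (c : ℝ) (x : Fin n → ℝ) :
    pd μ (fun _ => c) x = 0 := by
  simp [pd]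

lemma hasFDerivAt_comp_coord {n : ℕ} {A : ℝ → ℝ} {A' : ℝ} {x : Fin n → ℝ} (i : Fin n)
    (hA : HasDerivAt A A' (x i)) :
    HasFDerivAt (fun y : Fin n → ℝ => A (y i))
      (A' • ContinuousLinearMap.proj (R := ℝ) (φ := fun _ : Fin n => ℝ) i) x :=
  hA.comp_hasFDerivAt x (ContinuousLinearMap.proj (R := ℝ) (φ := fun _ : Fin n => ℝ) i).hasFDerivAt

/-- The partial derivatives of a function with separated variables. -/
lemma pd_separated {A B C : ℝ → ℝ} {A' B' C' : ℝ} {x : Fin 4 → ℝ}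
    (hA : HasDerivAt A A' (x 0)) (hB : HasDerivAt B B' (x 1)) (hC : HasDerivAt C C' (x 2))
    (μ : Fin 4) :
    pd μ (fun y => A (y 0) * B (y 1) * C (y 2)) x =
      (![A' * B (x 1) * C (x 2), A (x 0) * B' * C (x 2), A (x 0) * B (x 1) * C', 0] :
        Fin 4 → ℝ) μ := by
  have h := ((hasFDerivAt_comp_coord 0 hA).fun_mul (hasFDerivAt_comp_coord 1 hB)).fun_mul
    (hasFDerivAt_comp_coord 2 hC)
  unfold pd
  rw [h.fderiv]
  fin_cases μ <;> simp <;> ring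

/-! The coordinate chart and the metric. -/

lemma isOpen_flrwChart {I : Set ℝ} (hI : IsOpen I) (k : ℝ) : IsOpen (flrwChart I k) := by
  have h0 : IsOpen {x : Fin 4 → ℝ | x 0 ∈ I} := hI.preimage (continuous_apply 0)
  have h1 : IsOpen {x : Fin 4 → ℝ | 0 < x 1} := isOpen_lt continuous_const (continuous_apply 1)
  have h2 : IsOpen {x : Fin 4 → ℝ | k * x 1 ^ 2 < 1} :=
    isOpen_lt (by fun_prop) continuous_const
  have h3 : IsOpen {x : Fin 4 → ℝ | x 2 ∈ Set.Ioo 0 Real.pi} :=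
    isOpen_Ioo.preimage (continuous_apply 2)
  have h4 : IsOpen {x : Fin 4 → ℝ | x 3 ∈ Set.Ioo 0 (2 * Real.pi)} :=
    isOpen_Ioo.preimage (continuous_apply 3)
  exact h0.inter (h1.inter (h2.inter (h3.inter h4)))

lemma exists_radius (k : ℝ) : ∃ r : ℝ, 0 < r ∧ k * r ^ 2 < 1 := by
  refine ⟨1 / (1 + |k|), by positivity, ?_⟩
  have hk : 0 < 1 + |k| := by positivity
  rw [div_pow, one_pow, mul_one_div, div_lt_one (by positivity)]
  nlinarith [le_abs_self k, abs_nonneg k]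

/-- The diagonal entries of the FLRW metric. -/
def flrwDiag (a : ℝ → ℝ) (k : ℝ) (x : Fin 4 → ℝ) : Fin 4 → ℝ :=
  ![-1, a (x 0) ^ 2 / (1 - k * x 1 ^ 2), a (x 0) ^ 2 * x 1 ^ 2,
    a (x 0) ^ 2 * x 1 ^ 2 * Real.sin (x 2) ^ 2]

lemma flrw_apply (a : ℝ → ℝ) (k : ℝ) (x : Fin 4 → ℝ) (μ ν : Fin 4) :
    flrw a k x μ ν = if μ = ν then flrwDiag a k x μ else 0 := by
  simp only [flrw, flrwDiag, Matrix.diagonal_apply]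

section Chart

variable {I : Set ℝ} {a : ℝ → ℝ} {k : ℝ} {x : Fin 4 → ℝ}

lemma one_sub_pos (hx : x ∈ flrwChart I k) : 0 < 1 - k * x 1 ^ 2 := sub_pos.2 hx.2.2.1

lemma sin_pos_of_mem (hx : x ∈ flrwChart I k) : 0 < Real.sin (x 2) :=
  Real.sin_pos_of_mem_Ioo hx.2.2.2.1

lemma flrwDiag_ne_zero (ha : ∀ t ∈ I, 0 < a t) (hx : x ∈ flrwChart I k) (μ : Fin 4) :
    flrwDiag a k x μ ≠ 0 := by
  have h0 := (ha _ hx.1).ne'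
  have h1 := hx.2.1.ne'
  have h2 := (one_sub_pos hx).ne'
  have h3 := (sin_pos_of_mem hx).ne'
  fin_cases μ <;> simp [flrwDiag, h0, h1, h2, h3]

lemma flrw_inv_apply (ha : ∀ t ∈ I, 0 < a t) (hx : x ∈ flrwChart I k) (μ ν : Fin 4) :
    (flrw a k x)⁻¹ μ ν = if μ = ν then (flrwDiag a k x μ)⁻¹ else 0 := by
  have h : flrw a k x * Matrix.diagonal (fun μ => (flrwDiag a k x μ)⁻¹) = 1 := by
    rw [flrw, ← flrwDiag, Matrix.diagonal_mul_diagonal, ← Matrix.diagonal_one]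
    congr 1
    ext μ
    exact mul_inv_cancel₀ (flrwDiag_ne_zero ha hx μ)
  rw [Matrix.inv_eq_right_inv h, Matrix.diagonal_apply]

lemma sqrt_abs_det_flrw (ha : ∀ t ∈ I, 0 < a t) (hx : x ∈ flrwChart I k) :
    √|(flrw a k x).det| =
      a (x 0) ^ 3 * (x 1 ^ 2 * (√(1 - k * x 1 ^ 2))⁻¹) * Real.sin (x 2) := by
  have h0 := ha _ hx.1
  have h1 := hx.2.1
  have h2 := one_sub_pos hx
  have h3 := sin_pos_of_mem hx
  have hs := Real.sqrt_pos.2 h2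
  have : (flrw a k x).det =
      -(a (x 0) ^ 3 * (x 1 ^ 2 * (√(1 - k * x 1 ^ 2))⁻¹) * Real.sin (x 2)) ^ 2 := by
    rw [flrw, Matrix.det_diagonal, Fin.prod_univ_four]
    simp only [mul_pow, inv_pow, Real.sq_sqrt h2.le]
    simp
    field_simp
  rw [this, abs_neg, abs_of_nonneg (sq_nonneg _), Real.sqrt_sq (by positivity)]

/-! Christoffel symbols. -/

/-- The time factor of the Christoffel symbols of the FLRW metric. -/
def christoffelTime (a : ℝ → ℝ) : Fin 4 → Fin 4 → Fin 4 → ℝ → ℝ :=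
  let A := fun t => a t * deriv a t
  let H := fun t => deriv a t / a t
  let O := fun _ => (0 : ℝ)
  let E := fun _ => (1 : ℝ)
  ![![![O, O, O, O], ![O, A, O, O], ![O, O, A, O], ![O, O, O, A]],
    ![![O, H, O, O], ![H, E, O, O], ![O, O, E, O], ![O, O, O, E]],
    ![![O, O, H, O], ![O, O, E, O], ![H, E, O, O], ![O, O, O, E]],
    ![![O, O, O, H], ![O, O, O, E], ![O, O, O, E], ![H, E, E, O]]]

/-- The radial factor of the Christoffel symbols of the FLRW metric. -/
def christoffelRadial (k : ℝ) : Fin 4 → Fin 4 → Fin 4 → ℝ → ℝ :=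
  let B := fun r => 1 / (1 - k * r ^ 2)
  let S := fun r => r ^ 2
  let C := fun r => k * r / (1 - k * r ^ 2)
  let D := fun r => -(r * (1 - k * r ^ 2))
  let J := fun r => 1 / r
  let E := fun _ => (1 : ℝ)
  ![![![E, E, E, E], ![E, B, E, E], ![E, E, S, E], ![E, E, E, S]],
    ![![E, E, E, E], ![E, C, E, E], ![E, E, D, E], ![E, E, E, D]],
    ![![E, E, E, E], ![E, E, J, E], ![E, J, E, E], ![E, E, E, E]],
    ![![E, E, E, E], ![E, E, E, J], ![E, E, E, E], ![E, J, E, E]]]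

/-- The polar factor of the Christoffel symbols of the FLRW metric. -/
def christoffelPolar : Fin 4 → Fin 4 → Fin 4 → ℝ → ℝ :=
  let S := fun θ => Real.sin θ ^ 2
  let P := fun θ => -(Real.sin θ * Real.cos θ)
  let Q := fun θ => Real.cos θ / Real.sin θ
  let E := fun _ => (1 : ℝ)
  ![![![E, E, E, E], ![E, E, E, E], ![E, E, E, E], ![E, E, E, S]],
    ![![E, E, E, E], ![E, E, E, E], ![E, E, E, E], ![E, E, E, S]],
    ![![E, E, E, E], ![E, E, E, E], ![E, E, E, E], ![E, E, E, P]],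
    ![![E, E, E, E], ![E, E, E, E], ![E, E, E, Q], ![E, E, Q, E]]]

lemma hasDerivAt_one_sub_mul_sq (k r : ℝ) :
    HasDerivAt (fun r => 1 - k * r ^ 2) (-(2 * k * r)) r := by
  have h := ((hasDerivAt_pow 2 r).const_mul k).const_sub 1
  exact h.congr_deriv (by simp; ring)

/-- The first derivatives of the metric. -/
lemma pd_flrw (ha : ∀ t ∈ I, 0 < a t) (ha' : DifferentiableAt ℝ a (x 0))
    (hx : x ∈ flrwChart I k) (μ ν l : Fin 4) :
    pd l (fun y => flrw a k y μ ν) x = if μ = ν then flrwDiag a k x μ * (![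
      ![0, 0, 0, 0],
      ![2 * deriv a (x 0) / a (x 0), 2 * k * x 1 / (1 - k * x 1 ^ 2), 0, 0],
      ![2 * deriv a (x 0) / a (x 0), 2 / x 1, 0, 0],
      ![2 * deriv a (x 0) / a (x 0), 2 / x 1, 2 * Real.cos (x 2) / Real.sin (x 2), 0]] :
        Matrix (Fin 4) (Fin 4) ℝ) μ l else 0 := by
  have h0 := (ha _ hx.1).ne'
  have h1 := hx.2.1.ne'
  have h2 := (one_sub_pos hx).ne'
  have h3 := (sin_pos_of_mem hx).ne'
  simp only [flrw_apply]
  split_ifs with h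
  swap
  · exact pd_const _ _ _
  have hA : HasDerivAt (fun t => a t ^ 2) (2 * a (x 0) * deriv a (x 0)) (x 0) :=
    (ha'.hasDerivAt.pow 2).congr_deriv (by simp)
  have hB : HasDerivAt (fun r : ℝ => r ^ 2) (2 * x 1) (x 1) :=
    (hasDerivAt_pow 2 (x 1)).congr_deriv (by simp)
  have hB' : HasDerivAt (fun r => (1 - k * r ^ 2)⁻¹) (2 * k * x 1 / (1 - k * x 1 ^ 2) ^ 2) (x 1) :=
    ((hasDerivAt_one_sub_mul_sq k (x 1)).inv h2).congr_deriv (by simp)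
  have hC : HasDerivAt (fun θ => Real.sin θ ^ 2) (2 * Real.sin (x 2) * Real.cos (x 2)) (x 2) :=
    ((Real.hasDerivAt_sin (x 2)).pow 2).congr_deriv (by simp)
  have hone : HasDerivAt (fun _ : ℝ => (1 : ℝ)) 0 (x 2) := hasDerivAt_const _ _
  have e1 := pd_separated hA hB' hone l
  have e2 := pd_separated hA hB hone l
  have e3 := pd_separated hA hB hC l
  simp only [mul_one] at e1 e2
  simp only [← div_eq_mul_inv] at e1
  clear h
  fin_cases μ
  · simp [flrwDiag]
    fin_cases l <;> rfl
  · simp only [flrwDiag, Fin.mk_one, Matrix.cons_val_one, Matrix.cons_val_zero]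
    rw [e1]
    fin_cases l <;> simp <;> field_simp
  · simp only [flrwDiag, Fin.reduceFinMk, Matrix.cons_val]
    rw [e2]
    fin_cases l <;> simp <;> field_simp
  · simp only [flrwDiag, Fin.reduceFinMk, Matrix.cons_val]
    rw [e3]
    fin_cases l <;> simp <;> field_simp

set_option maxHeartbeats 2000000 in
-- Each symbol is a product of one-variable functions, so `pd_separated` can differentiate it. A
-- vanishing symbol is recorded by a zero time factor, its other two factors being 1.
lemma christoffel_flrw (ha : ∀ t ∈ I, 0 < a t) (ha' : DifferentiableAt ℝ a (x 0))
    (hx : x ∈ flrwChart I k) (l μ ν : Fin 4) :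
    christoffel (flrw a k) l μ ν x =
      christoffelTime a l μ ν (x 0) * christoffelRadial k l μ ν (x 1)
        * christoffelPolar l μ ν (x 2) := by
  have h0 := (ha _ hx.1).ne'
  have h1 := hx.2.1.ne'
  have h2 := (one_sub_pos hx).ne'
  have h3 := (sin_pos_of_mem hx).ne'
  simp only [christoffel, flrw_inv_apply ha hx, pd_flrw ha ha' hx, ite_mul, zero_mul,
    Finset.sum_ite_eq, Finset.mem_univ, if_true]
  fin_cases l <;> fin_cases μ <;> fin_cases ν <;>
    simp [flrwDiag, christoffelTime, christoffelRadial, christoffelPolar] <;> field_simp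

end Chart

/-! ### Ricci tensor and scalar curvature. -/

section Ricci

variable {I : Set ℝ} {a : ℝ → ℝ} {k : ℝ} {x : Fin 4 → ℝ}

lemma differentiableAt_christoffelTime {t : ℝ} (h0 : a t ≠ 0) (h : DifferentiableAt ℝ a t)
    (h' : DifferentiableAt ℝ (deriv a) t) (l μ ν : Fin 4) :
    DifferentiableAt ℝ (christoffelTime a l μ ν) t := by
  simp only [christoffelTime]
  fin_cases l <;> fin_cases μ <;> fin_cases ν <;> simp only [Fin.zero_eta, Fin.mk_one,
    Fin.reduceFinMk, Matrix.cons_val] <;> first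
    | exact h.mul h'
    | exact h'.div h h0
    | exact differentiableAt_const _

lemma differentiableAt_christoffelRadial {r : ℝ} (h1 : r ≠ 0) (h2 : 1 - k * r ^ 2 ≠ 0)
    (l μ ν : Fin 4) : DifferentiableAt ℝ (christoffelRadial k l μ ν) r := by
  simp only [christoffelRadial]
  fin_cases l <;> fin_cases μ <;> fin_cases ν <;> simp only [Fin.zero_eta, Fin.mk_one,
    Fin.reduceFinMk, Matrix.cons_val] <;> fun_prop (disch := assumption)

lemma differentiableAt_christoffelPolar {θ : ℝ} (h3 : Real.sin θ ≠ 0) (l μ ν : Fin 4) :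
    DifferentiableAt ℝ (christoffelPolar l μ ν) θ := by
  simp only [christoffelPolar]
  fin_cases l <;> fin_cases μ <;> fin_cases ν <;> simp only [Fin.zero_eta, Fin.mk_one,
    Fin.reduceFinMk, Matrix.cons_val] <;> fun_prop (disch := assumption)

lemma pd_christoffel_flrw (hI : IsOpen I) (ha : ∀ t ∈ I, 0 < a t) (hs : ContDiffOn ℝ ∞ a I)
    (hx : x ∈ flrwChart I k) (α l μ ν : Fin 4) :
    pd α (christoffel (flrw a k) l μ ν) x =
      (![deriv (christoffelTime a l μ ν) (x 0) * christoffelRadial k l μ ν (x 1)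
          * christoffelPolar l μ ν (x 2),
        christoffelTime a l μ ν (x 0) * deriv (christoffelRadial k l μ ν) (x 1)
          * christoffelPolar l μ ν (x 2),
        christoffelTime a l μ ν (x 0) * christoffelRadial k l μ ν (x 1)
          * deriv (christoffelPolar l μ ν) (x 2), 0] : Fin 4 → ℝ) α := by
  have hd : ∀ t ∈ I, DifferentiableAt ℝ a t := fun t ht =>
    (hs.contDiffAt (hI.mem_nhds ht)).differentiableAt (by simp)
  have hd' : DifferentiableAt ℝ (deriv a) (x 0) :=
    ((hs.deriv_of_isOpen (m := ∞) hI (by simp)).contDiffAt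
      (hI.mem_nhds hx.1)).differentiableAt (by simp)
  -- The closed form holds on the whole open chart, not just at `x`, so it may be differentiated.
  rw [pd_congr_on (isOpen_flrwChart hI k)
    (fun y hy => christoffel_flrw ha (hd _ hy.1) hy l μ ν) hx]
  exact pd_separated
    (differentiableAt_christoffelTime (ha _ hx.1).ne' (hd _ hx.1) hd' l μ ν).hasDerivAt
    (differentiableAt_christoffelRadial hx.2.1.ne' (one_sub_pos hx).ne' l μ ν).hasDerivAt
    (differentiableAt_christoffelPolar (sin_pos_of_mem hx).ne' l μ ν).hasDerivAt α

lemma pd_christoffel_flrw_zero (hI : IsOpen I) (ha : ∀ t ∈ I, 0 < a t) (hs : ContDiffOn ℝ ∞ a I)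
    (hx : x ∈ flrwChart I k) (l μ ν : Fin 4) :
    pd 0 (christoffel (flrw a k) l μ ν) x =
      deriv (christoffelTime a l μ ν) (x 0) * christoffelRadial k l μ ν (x 1)
        * christoffelPolar l μ ν (x 2) :=
  pd_christoffel_flrw hI ha hs hx 0 l μ ν

lemma pd_christoffel_flrw_one (hI : IsOpen I) (ha : ∀ t ∈ I, 0 < a t) (hs : ContDiffOn ℝ ∞ a I)
    (hx : x ∈ flrwChart I k) (l μ ν : Fin 4) :
    pd 1 (christoffel (flrw a k) l μ ν) x =
      christoffelTime a l μ ν (x 0) * deriv (christoffelRadial k l μ ν) (x 1)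
        * christoffelPolar l μ ν (x 2) :=
  pd_christoffel_flrw hI ha hs hx 1 l μ ν

lemma pd_christoffel_flrw_two (hI : IsOpen I) (ha : ∀ t ∈ I, 0 < a t) (hs : ContDiffOn ℝ ∞ a I)
    (hx : x ∈ flrwChart I k) (l μ ν : Fin 4) :
    pd 2 (christoffel (flrw a k) l μ ν) x =
      christoffelTime a l μ ν (x 0) * christoffelRadial k l μ ν (x 1)
        * deriv (christoffelPolar l μ ν) (x 2) :=
  pd_christoffel_flrw hI ha hs hx 2 l μ ν

lemma pd_christoffel_flrw_three (hI : IsOpen I) (ha : ∀ t ∈ I, 0 < a t) (hs : ContDiffOn ℝ ∞ a I)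
    (hx : x ∈ flrwChart I k) (l μ ν : Fin 4) :
    pd 3 (christoffel (flrw a k) l μ ν) x = 0 :=
  pd_christoffel_flrw hI ha hs hx 3 l μ ν

/-- The ratios `R_{μμ} / g_{μμ}` for the FLRW metric, as functions of time. -/
def ricciRatio (a : ℝ → ℝ) (k : ℝ) (t : ℝ) : Fin 4 → ℝ :=
  let s := deriv (deriv a) t / a t + 2 * (deriv a t / a t) ^ 2 + 2 * k / a t ^ 2
  ![3 * (deriv (deriv a) t / a t), s, s, s]

set_option maxHeartbeats 2000000 in
/-- The Ricci tensor of the FLRW metric. -/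
lemma ricci_flrw (hI : IsOpen I) (ha : ∀ t ∈ I, 0 < a t) (hs : ContDiffOn ℝ ∞ a I)
    (hx : x ∈ flrwChart I k) (μ ν : Fin 4) :
    ricci (flrw a k) μ ν x =
      if μ = ν then flrwDiag a k x μ * ricciRatio a k (x 0) μ else 0 := by
  have h0 := (ha _ hx.1).ne'
  have h1 := hx.2.1.ne'
  have h2 := (one_sub_pos hx).ne'
  have h3 := (sin_pos_of_mem hx).ne'
  have hd : DifferentiableAt ℝ a (x 0) :=
    (hs.contDiffAt (hI.mem_nhds hx.1)).differentiableAt (by simp)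
  have hd' : DifferentiableAt ℝ (deriv a) (x 0) :=
    ((hs.deriv_of_isOpen (m := ∞) hI (by simp)).contDiffAt
      (hI.mem_nhds hx.1)).differentiableAt (by simp)
  have t1 : deriv (fun t => a t * deriv a t) (x 0) =
      deriv a (x 0) * deriv a (x 0) + a (x 0) * deriv (deriv a) (x 0) := by
    rw [deriv_fun_mul hd hd']
  have t2 : deriv (fun t => deriv a t / a t) (x 0) =
      (deriv (deriv a) (x 0) * a (x 0) - deriv a (x 0) * deriv a (x 0)) / a (x 0) ^ 2 := by
    rw [deriv_fun_div hd' hd h0]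
  have hb := hasDerivAt_one_sub_mul_sq k (x 1)
  have r3 : deriv (fun r => k * r / (1 - k * r ^ 2)) (x 1) =
      (k * (1 - k * x 1 ^ 2) + k * x 1 * (2 * k * x 1)) / (1 - k * x 1 ^ 2) ^ 2 := by
    rw [(((hasDerivAt_id' (x 1)).const_mul k).fun_div hb h2).deriv]
    ring
  have r4 : deriv (fun r => -(r * (1 - k * r ^ 2))) (x 1) = -1 + 3 * k * x 1 ^ 2 := by
    rw [((hasDerivAt_id' (x 1)).fun_mul hb).fun_neg.deriv]
    ring
  have r5 : deriv (fun r : ℝ => 1 / r) (x 1) = -1 / x 1 ^ 2 := by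
    simp [neg_div]
  have p2 : deriv (fun θ => -(Real.sin θ * Real.cos θ)) (x 2) =
      Real.sin (x 2) ^ 2 - Real.cos (x 2) ^ 2 := by
    rw [((Real.hasDerivAt_sin (x 2)).fun_mul (Real.hasDerivAt_cos (x 2))).fun_neg.deriv]
    ring
  have p3 : deriv (fun θ => Real.cos θ / Real.sin θ) (x 2) =
      (-Real.sin (x 2) ^ 2 - Real.cos (x 2) ^ 2) / Real.sin (x 2) ^ 2 := by
    rw [((Real.hasDerivAt_cos (x 2)).fun_div (Real.hasDerivAt_sin (x 2)) h3).deriv]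
    ring
  have h2' : 1 - x 1 ^ 2 * k ≠ 0 := by rwa [mul_comm]
  -- Eliminating the squared cosine turns the trigonometric components into rational identities.
  have hc : Real.cos (x 2) ^ 2 = 1 - Real.sin (x 2) ^ 2 := by
    rw [← Real.sin_sq_add_cos_sq (x 2)]; ring
  fin_cases μ <;> fin_cases ν <;>
    simp only [ricci, Fin.sum_univ_four, Fin.zero_eta, Fin.mk_one, Fin.reduceFinMk, Fin.isValue,
      pd_christoffel_flrw_zero hI ha hs hx, pd_christoffel_flrw_one hI ha hs hx,
      pd_christoffel_flrw_two hI ha hs hx, pd_christoffel_flrw_three hI ha hs hx,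
      christoffel_flrw ha hd hx] <;>
    simp only [christoffelTime, christoffelRadial, christoffelPolar, Matrix.cons_val] <;>
    simp only [deriv_const, mul_zero, zero_mul, add_zero,
      zero_add, mul_one, one_mul, sub_zero, zero_sub, flrwDiag, ricciRatio,
      Matrix.cons_val, Fin.isValue, Fin.reduceEq, if_true, if_false] <;>
    (try simp only [t1, t2, r3, r4, r5, p2, p3]) <;>
    field_simp <;> (try rw [hc]) <;> ring

/-- The metric entries cancel in each `g^{μμ} R_{μμ}`, so only time remains; the reduction of all
nonlocal terms starts here. -/
lemma scalarCurv_flrw (hI : IsOpen I) (ha : ∀ t ∈ I, 0 < a t) (hs : ContDiffOn ℝ ∞ a I)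
    (hx : x ∈ flrwChart I k) :
    scalarCurv (flrw a k) x = ∑ μ, ricciRatio a k (x 0) μ := by
  simp only [scalarCurv, ricci_flrw hI ha hs hx, flrw_inv_apply ha hx, ite_mul, zero_mul,
    Finset.sum_ite_eq, Finset.mem_univ, if_true, inv_mul_cancel_left₀ (flrwDiag_ne_zero ha hx _)]

end Ricci

/-! Functions of time alone. -/

section TimeFunction

variable {I : Set ℝ} {a : ℝ → ℝ} {k : ℝ} {x : Fin 4 → ℝ} {u v : (Fin 4 → ℝ) → ℝ} {w z : ℝ → ℝ}

/-- Agreement with `w` is asked only on the chart, since off it the curvature is not controlled;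
openness makes this enough. -/
lemma pd_time (hI : IsOpen I) (hu : ∀ y ∈ flrwChart I k, u y = w (y 0))
    (hx : x ∈ flrwChart I k) (hw : DifferentiableAt ℝ w (x 0)) (μ : Fin 4) :
    pd μ u x = if μ = 0 then deriv w (x 0) else 0 := by
  rw [pd_congr_on (isOpen_flrwChart hI k) hu hx]
  have h := pd_separated hw.hasDerivAt (hasDerivAt_const (x 1) (1 : ℝ))
    (hasDerivAt_const (x 2) (1 : ℝ)) μ
  simp only [mul_one] at h
  rw [h]
  fin_cases μ <;> simp

lemma gradProd_time (hI : IsOpen I) (ha : ∀ t ∈ I, 0 < a t)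
    (hu : ∀ y ∈ flrwChart I k, u y = w (y 0)) (hv : ∀ y ∈ flrwChart I k, v y = z (y 0))
    (hx : x ∈ flrwChart I k) (hw : DifferentiableAt ℝ w (x 0)) (hz : DifferentiableAt ℝ z (x 0)) :
    gradProd (flrw a k) u v x = -(deriv w (x 0) * deriv z (x 0)) := by
  simp [gradProd, flrw_inv_apply ha hx, pd_time hI hu hx hw, pd_time hI hv hx hz, flrwDiag]

/-- The d'Alembert operator of the FLRW metric on functions of time. -/
def boxTime (a w : ℝ → ℝ) (t : ℝ) : ℝ :=
  -(deriv (deriv w) t + 3 * (deriv a t / a t) * deriv w t)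

lemma differentiableAt_of_contDiffOn (hI : IsOpen I) {n : WithTop ℕ∞} (hn : n ≠ 0)
    (hw : ContDiffOn ℝ n w I) {t : ℝ} (ht : t ∈ I) : DifferentiableAt ℝ w t :=
  (hw.contDiffAt (hI.mem_nhds ht)).differentiableAt hn

lemma differentiableAt_deriv_of_contDiffOn (hI : IsOpen I) (hw : ContDiffOn ℝ 2 w I)
    {t : ℝ} (ht : t ∈ I) : DifferentiableAt ℝ (deriv w) t :=
  differentiableAt_of_contDiffOn hI one_ne_zero
    (hw.deriv_of_isOpen (m := 1) hI (by norm_num)) ht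

/-- The flux `√|g| g^{μν} ∂_ν u` has only a time component, `-a³ w'` times a spatial factor. That
factor passes through `∂_t` and cancels against `1/√|g|`. -/
lemma box_time (hI : IsOpen I) (ha : ∀ t ∈ I, 0 < a t) (hs : ContDiffOn ℝ ∞ a I)
    (hu : ∀ y ∈ flrwChart I k, u y = w (y 0)) (hw : ContDiffOn ℝ 2 w I)
    (hx : x ∈ flrwChart I k) : box (flrw a k) u x = boxTime a w (x 0) := by
  have h0 := (ha _ hx.1).ne'
  have h1 := hx.2.1.ne'
  have h3 := (sin_pos_of_mem hx).ne'
  have hr := (Real.sqrt_pos.2 (one_sub_pos hx)).ne'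
  have hd := differentiableAt_of_contDiffOn hI (by simp) hs hx.1
  have hw' := differentiableAt_deriv_of_contDiffOn hI hw hx.1
  have flux : ∀ μ : Fin 4, ∀ y ∈ flrwChart I k,
      √|(flrw a k y).det| * ∑ ν, (flrw a k y)⁻¹ μ ν * pd ν u y =
        if μ = 0 then (-(a (y 0) ^ 3 * deriv w (y 0))) * (y 1 ^ 2 * (√(1 - k * y 1 ^ 2))⁻¹)
          * Real.sin (y 2) else 0 := by
    intro μ y hy
    rw [sqrt_abs_det_flrw ha hy]
    simp only [flrw_inv_apply ha hy,
      pd_time hI hu hy (differentiableAt_of_contDiffOn hI two_ne_zero hw hy.1), ite_mul, zero_mul,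
      mul_ite, mul_zero]
    split_ifs with h
    · subst h
      simp [flrwDiag]
      ring
    · simp [h]
  have hA : HasDerivAt (fun t => -(a t ^ 3 * deriv w t))
      (a (x 0) ^ 3 * boxTime a w (x 0)) (x 0) := by
    refine ((hd.hasDerivAt.fun_pow 3).fun_mul hw'.hasDerivAt).fun_neg.congr_deriv ?_
    simp only [boxTime]
    field_simp
    push_cast
    ring
  -- Differentiability suffices: the value of the radial derivative never enters, because the radial
  -- flux vanishes.
  have hB : DifferentiableAt ℝ (fun r => r ^ 2 * (√(1 - k * r ^ 2))⁻¹) (x 1) :=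
    (differentiableAt_id.pow 2).mul
      (((hasDerivAt_one_sub_mul_sq k (x 1)).differentiableAt.sqrt (one_sub_pos hx).ne').inv hr)
  have hflux : ∀ μ : Fin 4,
      pd μ (fun y => √|(flrw a k y).det| * ∑ ν, (flrw a k y)⁻¹ μ ν * pd ν u y) x =
        if μ = 0 then a (x 0) ^ 3 * boxTime a w (x 0) * (x 1 ^ 2 * (√(1 - k * x 1 ^ 2))⁻¹)
          * Real.sin (x 2) else 0 := by
    intro μ
    rw [pd_congr_on (isOpen_flrwChart hI k) (flux μ) hx]
    split_ifs with h
    · subst h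
      exact pd_separated hA hB.hasDerivAt (Real.hasDerivAt_sin (x 2)) 0
    · exact pd_const _ _ _
  rw [box, sqrt_abs_det_flrw ha hx]
  simp only [hflux, Finset.sum_ite_eq', Finset.mem_univ, if_true]
  generalize √(1 - k * x 1 ^ 2) = s at hr ⊢
  field_simp

/-- The ratios `K_{μμ} w / g_{μμ}` for the FLRW metric and a function of time `w`. -/
def opKRatio (a w : ℝ → ℝ) (t : ℝ) : Fin 4 → ℝ :=
  let s := -(deriv a t / a t * deriv w t) - boxTime a w t
  ![-deriv (deriv w) t - boxTime a w t, s, s, s]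

/-- The spatial Hessian is `-Γ^0_{ij} w'`, and `Γ^0_{ij} = (a'/a) g_{ij}`, so it is a multiple of
the metric. This isotropy makes the three spatial equations agree. -/
lemma opK_time (hI : IsOpen I) (ha : ∀ t ∈ I, 0 < a t) (hs : ContDiffOn ℝ ∞ a I)
    (hu : ∀ y ∈ flrwChart I k, u y = w (y 0)) (hw : ContDiffOn ℝ 2 w I)
    (hx : x ∈ flrwChart I k) (μ ν : Fin 4) :
    opK (flrw a k) μ ν u x =
      if μ = ν then flrwDiag a k x μ * opKRatio a w (x 0) μ else 0 := by
  have h0 := (ha _ hx.1).ne'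
  have h2 := (one_sub_pos hx).ne'
  have hd := differentiableAt_of_contDiffOn hI (by simp) hs hx.1
  have hw1 : ∀ y ∈ flrwChart I k, DifferentiableAt ℝ w (y 0) := fun y hy =>
    differentiableAt_of_contDiffOn hI two_ne_zero hw hy.1
  have hw' := differentiableAt_deriv_of_contDiffOn hI hw hx.1
  have hpd : pd μ (pd ν u) x =
      if μ = 0 then (if ν = 0 then deriv (deriv w) (x 0) else 0) else 0 := by
    by_cases h : ν = 0
    · simp only [h, if_true]
      exact pd_time (w := deriv w) hI (fun y hy => by simpa using pd_time hI hu hy (hw1 y hy) 0)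
        hx hw' μ
    · rw [pd_congr_on (isOpen_flrwChart hI k) (v := fun _ => 0)
        (fun y hy => by simpa [h] using pd_time hI hu hy (hw1 y hy) ν) hx]
      simp [h]
  rw [opK, hess, hpd, box_time hI ha hs hu hw hx, flrw_apply]
  simp only [pd_time hI hu hx (hw1 x hx), christoffel_flrw ha hd hx, mul_ite, mul_zero,
    Finset.sum_ite_eq', Finset.mem_univ, if_true]
  fin_cases μ <;> fin_cases ν <;>
    simp [christoffelTime, christoffelRadial, christoffelPolar, flrwDiag, opKRatio] <;>
    (try field_simp) <;> ring

lemma contDiffOn_boxTime (hI : IsOpen I) (ha : ∀ t ∈ I, 0 < a t) (hs : ContDiffOn ℝ ∞ a I)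
    (hw : ContDiffOn ℝ ∞ w I) : ContDiffOn ℝ ∞ (boxTime a w) I := by
  have hw1 : ContDiffOn ℝ ∞ (deriv w) I := hw.deriv_of_isOpen hI (by simp)
  have hw2 : ContDiffOn ℝ ∞ (deriv (deriv w)) I := hw1.deriv_of_isOpen hI (by simp)
  have hs1 : ContDiffOn ℝ ∞ (deriv a) I := hs.deriv_of_isOpen hI (by simp)
  exact (hw2.add ((contDiffOn_const.mul (hs1.div hs fun t ht => (ha t ht).ne')).mul hw1)).neg

/-- Smoothness must be carried through the induction, since `box_time` needs two derivatives of the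
previous iterate. -/
lemma boxPow_time (hI : IsOpen I) (ha : ∀ t ∈ I, 0 < a t) (hs : ContDiffOn ℝ ∞ a I)
    (hu : ∀ y ∈ flrwChart I k, u y = w (y 0)) (hw : ContDiffOn ℝ ∞ w I) (m : ℕ) :
    ContDiffOn ℝ ∞ ((boxTime a)^[m] w) I ∧
      ∀ y ∈ flrwChart I k, boxPow (flrw a k) m u y = (boxTime a)^[m] w (y 0) := by
  induction m with
  | zero => exact ⟨hw, hu⟩
  | succ m ih =>
    simp only [boxPow, Function.iterate_succ_apply'] at ih ⊢
    exact ⟨contDiffOn_boxTime hI ha hs ih.1,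
      fun y hy => box_time hI ha hs ih.2 (by exact_mod_cast contDiffOn_infty.1 ih.1 2) hy⟩

end TimeFunction

/-! The nonlocal terms on the FLRW chart. -/

section Nonlocal

variable {I : Set ℝ} {a : ℝ → ℝ} {k : ℝ} {x : Fin 4 → ℝ}

/-- A curve of comoving points, parametrised by time. -/
def comoving (r t : ℝ) : Fin 4 → ℝ := ![t, r, Real.pi / 2, Real.pi]

lemma comoving_mem {r t : ℝ} (hr : 0 < r) (hkr : k * r ^ 2 < 1) (ht : t ∈ I) :
    comoving r t ∈ flrwChart I k := by
  have := Real.pi_pos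
  refine ⟨ht, hr, hkr, ⟨?_, ?_⟩, ⟨?_, ?_⟩⟩ <;> simp only [comoving, Matrix.cons_val] <;> linarith

lemma contDiff_comoving (r : ℝ) (n : WithTop ℕ∞) : ContDiff ℝ n (comoving r) := by
  refine contDiff_pi.2 fun i => ?_
  fin_cases i
  · exact contDiff_id
  all_goals exact contDiff_const

/-- Restriction to a comoving curve. It turns the assumed `C²` regularity of `Φ` into regularity in
`t`, which pointwise convergence of the series would not give. -/
lemma contDiffOn_time {n : WithTop ℕ∞} {u : (Fin 4 → ℝ) → ℝ} {w : ℝ → ℝ}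
    (h : ContDiffOn ℝ n u (flrwChart I k)) (hu : ∀ y ∈ flrwChart I k, u y = w (y 0)) :
    ContDiffOn ℝ n w I := by
  obtain ⟨r, hr, hkr⟩ := exists_radius k
  exact (h.comp (contDiff_comoving r n).contDiffOn fun t ht => comoving_mem hr hkr ht).congr
    fun t ht => (hu _ (comoving_mem hr hkr ht)).symm

lemma contDiffOn_ricciRatio (hI : IsOpen I) (ha : ∀ t ∈ I, 0 < a t) (hs : ContDiffOn ℝ ∞ a I)
    (μ : Fin 4) : ContDiffOn ℝ ∞ (fun t => ricciRatio a k t μ) I := by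
  have hs1 : ContDiffOn ℝ ∞ (deriv a) I := hs.deriv_of_isOpen hI (by simp)
  have hs2 : ContDiffOn ℝ ∞ (deriv (deriv a)) I := hs1.deriv_of_isOpen hI (by simp)
  have h0 : ∀ t ∈ I, a t ≠ 0 := fun t ht => (ha t ht).ne'
  have h1 : ContDiffOn ℝ ∞ (fun t => deriv (deriv a) t / a t) I := hs2.div hs h0
  have h : ContDiffOn ℝ ∞ (fun t => deriv (deriv a) t / a t + 2 * (deriv a t / a t) ^ 2
      + 2 * k / a t ^ 2) I :=
    (h1.add (contDiffOn_const.mul ((hs1.div hs h0).pow 2))).add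
      (contDiffOn_const.div (hs.pow 2) fun t ht => pow_ne_zero 2 (h0 t ht))
  fin_cases μ
  · exact contDiffOn_const.mul h1
  all_goals exact h

/-- The integer powers of the scalar curvature of the FLRW metric, as functions of time. -/
def curvPowTime (a : ℝ → ℝ) (k : ℝ) (p : ℤ) (t : ℝ) : ℝ :=
  (∑ μ, ricciRatio a k t μ) ^ p

lemma curvPow_flrw (hI : IsOpen I) (ha : ∀ t ∈ I, 0 < a t) (hs : ContDiffOn ℝ ∞ a I) (p : ℤ)
    (hx : x ∈ flrwChart I k) : curvPow (flrw a k) p x = curvPowTime a k p (x 0) := by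
  rw [curvPow, scalarCurv_flrw hI ha hs hx, curvPowTime]

lemma contDiffOn_curvPowTime (hI : IsOpen I) (ha : ∀ t ∈ I, 0 < a t) (hs : ContDiffOn ℝ ∞ a I)
    {p : ℤ} (hp : 0 ≤ p ∨ ∀ x ∈ flrwChart I k, scalarCurv (flrw a k) x ≠ 0) :
    ContDiffOn ℝ ∞ (curvPowTime a k p) I := by
  have h : ContDiffOn ℝ ∞ (fun t => ∑ μ, ricciRatio a k t μ) I :=
    ContDiffOn.sum fun μ _ => contDiffOn_ricciRatio hI ha hs μ
  rcases le_or_gt 0 p with h0 | h0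
  · lift p to ℕ using h0
    exact (h.pow p).congr fun t _ => by rw [curvPowTime, zpow_natCast]
  · have hR := hp.resolve_left h0.not_ge
    obtain ⟨r, hr, hkr⟩ := exists_radius k
    obtain ⟨m, rfl⟩ : ∃ m : ℕ, p = -m := ⟨(-p).toNat, by omega⟩
    have hne : ∀ t ∈ I, ∑ μ, ricciRatio a k t μ ≠ 0 := fun t ht => by
      have hc := comoving_mem hr hkr ht
      simpa only [scalarCurv_flrw hI ha hs hc] using! hR _ hc
    exact ((h.pow m).inv fun t ht => pow_ne_zero m (hne t ht)).congr fun t _ => by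
      rw [curvPowTime, zpow_neg, zpow_natCast]
      rfl

/-- The function `F(□) w` of a function of time `w`. -/
def nonlocalOpTime (a : ℝ → ℝ) (f : ℕ → ℝ) (w : ℝ → ℝ) (t : ℝ) : ℝ :=
  ∑'[conditional ℕ] m, f m * (boxTime a)^[m] w t

/-- The function `Φ` of the FLRW metric, as a function of time. -/
def PhiTime (a : ℝ → ℝ) (k : ℝ) (f : ℕ → ℝ) (p q : ℤ) (t : ℝ) : ℝ :=
  p * curvPowTime a k (p - 1) t * nonlocalOpTime a f (curvPowTime a k q) t
    + q * curvPowTime a k (q - 1) t * nonlocalOpTime a f (curvPowTime a k p) t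

/-- The terms agree one by one, so the sums agree even where the series diverges and takes its
default value. -/
lemma nonlocalOp_time (hI : IsOpen I) (ha : ∀ t ∈ I, 0 < a t) (hs : ContDiffOn ℝ ∞ a I)
    {u : (Fin 4 → ℝ) → ℝ} {w : ℝ → ℝ} (hu : ∀ y ∈ flrwChart I k, u y = w (y 0))
    (hw : ContDiffOn ℝ ∞ w I) (f : ℕ → ℝ) (hx : x ∈ flrwChart I k) :
    nonlocalOp (flrw a k) f u x = nonlocalOpTime a f w (x 0) :=
  tsum_congr fun m => by rw [(boxPow_time hI ha hs hu hw m).2 x hx]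

/-- The exponents `p - 1` and `q - 1` enter by value only, so `p = 0` or `q = 0` needs no regularity
of `R⁻¹`. -/
lemma Phi_flrw (hI : IsOpen I) (ha : ∀ t ∈ I, 0 < a t) (hs : ContDiffOn ℝ ∞ a I) (f : ℕ → ℝ)
    {p q : ℤ} (hp : ContDiffOn ℝ ∞ (curvPowTime a k p) I)
    (hq : ContDiffOn ℝ ∞ (curvPowTime a k q) I) (hx : x ∈ flrwChart I k) :
    Phi (flrw a k) f p q x = PhiTime a k f p q (x 0) := by
  rw [Phi, PhiTime, curvPow_flrw hI ha hs _ hx, curvPow_flrw hI ha hs _ hx,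
    nonlocalOp_time hI ha hs (fun _ hy => curvPow_flrw hI ha hs p hy) hp f hx,
    nonlocalOp_time hI ha hs (fun _ hy => curvPow_flrw hI ha hs q hy) hq f hx]

/-- The kinetic part `f_{m+1} ∑_l (□^l u)' (□^{m-l} v)'` of the series in the equations. -/
def kineticTerm (a : ℝ → ℝ) (f : ℕ → ℝ) (u v : ℝ → ℝ) (t : ℝ) (m : ℕ) : ℝ :=
  f (m + 1) * ∑ l ∈ range (m + 1),
    deriv ((boxTime a)^[l] u) t * deriv ((boxTime a)^[m - l] v) t

/-- The potential part `f_{m+1} ∑_l □^l u □^{m+1-l} v` of the series in the equations. -/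
def potentialTerm (a : ℝ → ℝ) (f : ℕ → ℝ) (u v : ℝ → ℝ) (t : ℝ) (m : ℕ) : ℝ :=
  f (m + 1) * ∑ l ∈ range (m + 1), (boxTime a)^[l] u t * (boxTime a)^[m + 1 - l] v t

/-- The gradient product contributes `-1` to the kinetic coefficient. For `μ = 0` the term `-2 ∂_0
∂_0` adds `+2`, because `g_{00} = -1`; for spatial indices it is absent. -/
lemma eomTerm_flrw (hI : IsOpen I) (ha : ∀ t ∈ I, 0 < a t) (hs : ContDiffOn ℝ ∞ a I) (f : ℕ → ℝ)
    {p q : ℤ} (hp : ContDiffOn ℝ ∞ (curvPowTime a k p) I)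
    (hq : ContDiffOn ℝ ∞ (curvPowTime a k q) I) (hx : x ∈ flrwChart I k) (μ ν : Fin 4) (m : ℕ) :
    eomTerm (flrw a k) f p q μ ν x m =
      if μ = ν then flrwDiag a k x μ *
        ((if μ = 0 then 1 else -1) *
            kineticTerm a f (curvPowTime a k p) (curvPowTime a k q) (x 0) m
          + potentialTerm a f (curvPowTime a k p) (curvPowTime a k q) (x 0) m) else 0 := by
  have hU := boxPow_time hI ha hs (fun _ hy => curvPow_flrw hI ha hs p hy) hp
  have hV := boxPow_time hI ha hs (fun _ hy => curvPow_flrw hI ha hs q hy) hq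
  have hU' := fun l => differentiableAt_of_contDiffOn hI (by simp) (hU l).1 hx.1
  have hV' := fun l => differentiableAt_of_contDiffOn hI (by simp) (hV l).1 hx.1
  simp only [eomTerm, kineticTerm, potentialTerm, flrw_apply,
    fun l n => gradProd_time hI ha (hU l).2 (hV n).2 hx (hU' l) (hV' n),
    fun l => pd_time hI (hU l).2 hx (hU' l), fun l => pd_time hI (hV l).2 hx (hV' l),
    fun l => (hU l).2 x hx, fun l => (hV l).2 x hx]
  by_cases h : μ = ν
  · subst h
    by_cases h : μ = 0
    · subst h
      simp only [if_true, flrwDiag, Matrix.cons_val, Finset.mul_sum, ← Finset.sum_add_distrib]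
      exact Finset.sum_congr rfl fun l _ => by ring
    · simp only [if_true, if_neg h, Finset.mul_sum, ← Finset.sum_add_distrib]
      exact Finset.sum_congr rfl fun l _ => by ring
  · by_cases h0 : μ = 0
    · have h1 : ν ≠ 0 := fun h1 => h (h0.trans h1.symm)
      simp [h, h1]
    · simp [h, h0]

lemma traceTerm_flrw (hI : IsOpen I) (ha : ∀ t ∈ I, 0 < a t) (hs : ContDiffOn ℝ ∞ a I)
    (f : ℕ → ℝ) {p q : ℤ} (hp : ContDiffOn ℝ ∞ (curvPowTime a k p) I)
    (hq : ContDiffOn ℝ ∞ (curvPowTime a k q) I) (hx : x ∈ flrwChart I k) (m : ℕ) :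
    traceTerm (flrw a k) f p q x m =
      -kineticTerm a f (curvPowTime a k p) (curvPowTime a k q) (x 0) m
        + 2 * potentialTerm a f (curvPowTime a k p) (curvPowTime a k q) (x 0) m := by
  have hU := boxPow_time hI ha hs (fun _ hy => curvPow_flrw hI ha hs p hy) hp
  have hV := boxPow_time hI ha hs (fun _ hy => curvPow_flrw hI ha hs q hy) hq
  have hU' := fun l => differentiableAt_of_contDiffOn hI (by simp) (hU l).1 hx.1
  have hV' := fun l => differentiableAt_of_contDiffOn hI (by simp) (hV l).1 hx.1
  simp only [traceTerm, kineticTerm, potentialTerm,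
    fun l n => gradProd_time hI ha (hU l).2 (hV n).2 hx (hU' l) (hV' n),
    fun l => (hU l).2 x hx, fun l => (hV l).2 x hx, Finset.mul_sum, ← Finset.sum_neg_distrib,
    ← Finset.sum_add_distrib]
  exact Finset.sum_congr rfl fun l _ => by ring

/-! ### The field equations as scalar equations in time. -/

/-- The left-hand side of the `μμ` equation of motion divided by `g_{μμ}`, for the FLRW metric, as a
function of time. -/
def eomRatio (a : ℝ → ℝ) (k : ℝ) (f : ℕ → ℝ) (p q : ℤ) (G Λ t : ℝ) (s : ℝ) (μ : Fin 4) : ℝ :=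
  1 / (16 * Real.pi * G) * (ricciRatio a k t μ - 1 / 2 * (∑ ν, ricciRatio a k t ν) + Λ)
    - 1 / 2 * (curvPowTime a k p t * nonlocalOpTime a f (curvPowTime a k q) t)
    + (ricciRatio a k t μ * PhiTime a k f p q t - opKRatio a (PhiTime a k f p q) t μ) + 1 / 2 * s

lemma eomRatio_eq_of_ne_zero (f : ℕ → ℝ) (p q : ℤ) (G Λ t s : ℝ) {μ : Fin 4} (hμ : μ ≠ 0) :
    eomRatio a k f p q G Λ t s μ = eomRatio a k f p q G Λ t s 1 := by
  have h1 : ricciRatio a k t μ = ricciRatio a k t 1 := by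
    fin_cases μ <;> simp_all [ricciRatio]
  have h2 : opKRatio a (PhiTime a k f p q) t μ = opKRatio a (PhiTime a k f p q) t 1 := by
    fin_cases μ <;> simp_all [opKRatio]
  simp only [eomRatio, h1, h2]

/-- The series in the `μμ` equation, divided by `g_{μμ}`. -/
def eomRatioTerm (a : ℝ → ℝ) (k : ℝ) (f : ℕ → ℝ) (p q : ℤ) (t : ℝ) (μ : Fin 4) (m : ℕ) : ℝ :=
  (if μ = 0 then 1 else -1) * kineticTerm a f (curvPowTime a k p) (curvPowTime a k q) t m
    + potentialTerm a f (curvPowTime a k p) (curvPowTime a k q) t m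

lemma eomComponent_flrw_of_ne (hI : IsOpen I) (ha : ∀ t ∈ I, 0 < a t) (hs : ContDiffOn ℝ ∞ a I)
    (f : ℕ → ℝ) {p q : ℤ} (hp : ContDiffOn ℝ ∞ (curvPowTime a k p) I)
    (hq : ContDiffOn ℝ ∞ (curvPowTime a k q) I) (G Λ : ℝ) {μ ν : Fin 4} (hμν : μ ≠ ν)
    (hN : NonlocalTermsDefined (flrw a k) f p q (flrwChart I k)) :
    EOMComponent (flrw a k) f p q G Λ (flrwChart I k) μ ν := by
  refine ⟨hN, fun x hx => ?_⟩
  have hΦ : ∀ y ∈ flrwChart I k, Phi (flrw a k) f p q y = PhiTime a k f p q (y 0) :=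
    fun y hy => Phi_flrw hI ha hs f hp hq hy
  have hE : eomTerm (flrw a k) f p q μ ν x = fun _ => 0 := by
    ext m
    rw [eomTerm_flrw hI ha hs f hp hq hx, if_neg hμν]
  rw [hE, opK_time hI ha hs hΦ (contDiffOn_time hN.contDiffOn_Phi hΦ) hx, einstein,
    ricci_flrw hI ha hs hx, flrw_apply]
  simp [hμν, summable_zero]

/-- Division by the nonzero entry `g_{μμ}`. Packing convergence and value of the series into one
`HasSum` lets equations be combined linearly later. -/
lemma eomComponent_flrw_self (hI : IsOpen I) (ha : ∀ t ∈ I, 0 < a t) (hs : ContDiffOn ℝ ∞ a I)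
    (f : ℕ → ℝ) {p q : ℤ} (hp : ContDiffOn ℝ ∞ (curvPowTime a k p) I)
    (hq : ContDiffOn ℝ ∞ (curvPowTime a k q) I) (G Λ : ℝ) (μ : Fin 4)
    (hN : NonlocalTermsDefined (flrw a k) f p q (flrwChart I k)) :
    EOMComponent (flrw a k) f p q G Λ (flrwChart I k) μ μ ↔ ∀ x ∈ flrwChart I k,
      ∃ s, HasSum (eomRatioTerm a k f p q (x 0) μ) s (conditional ℕ) ∧
        eomRatio a k f p q G Λ (x 0) s μ = 0 := by
  have hΦ : ∀ y ∈ flrwChart I k, Phi (flrw a k) f p q y = PhiTime a k f p q (y 0) :=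
    fun y hy => Phi_flrw hI ha hs f hp hq hy
  refine (and_iff_right hN).trans (forall₂_congr fun x hx => ?_)
  have hg := flrwDiag_ne_zero ha hx μ
  have hE : eomTerm (flrw a k) f p q μ μ x =
      fun m => flrwDiag a k x μ * eomRatioTerm a k f p q (x 0) μ m := by
    ext m
    rw [eomTerm_flrw hI ha hs f hp hq hx, if_pos rfl, eomRatioTerm]
  rw [hE, opK_time hI ha hs hΦ (contDiffOn_time hN.contDiffOn_Phi hΦ) hx, einstein,
    ricci_flrw hI ha hs hx, flrw_apply, hΦ x hx, scalarCurv_flrw hI ha hs hx,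
    curvPow_flrw hI ha hs _ hx,
    nonlocalOp_time hI ha hs (fun _ hy => curvPow_flrw hI ha hs q hy) hq f hx,
    summable_mul_left_iff hg, tsum_mul_left]
  simp only [if_true]
  have key : ∀ s, 1 / (16 * Real.pi * G) * (flrwDiag a k x μ * ricciRatio a k (x 0) μ
        - 1 / 2 * (∑ ν, ricciRatio a k (x 0) ν) * flrwDiag a k x μ + Λ * flrwDiag a k x μ)
      - 1 / 2 * flrwDiag a k x μ * curvPowTime a k p (x 0)
        * nonlocalOpTime a f (curvPowTime a k q) (x 0)
      + (flrwDiag a k x μ * ricciRatio a k (x 0) μ * PhiTime a k f p q (x 0)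
        - flrwDiag a k x μ * opKRatio a (PhiTime a k f p q) (x 0) μ)
      + 1 / 2 * (flrwDiag a k x μ * s) =
      flrwDiag a k x μ * eomRatio a k f p q G Λ (x 0) s μ := fun s => by
    rw [eomRatio]; ring
  rw [key, mul_eq_zero, or_iff_right hg]
  constructor
  · rintro ⟨h1, h2⟩
    exact ⟨_, h1.hasSum, h2⟩
  · rintro ⟨s, h1, h2⟩
    exact ⟨h1.summable, by rwa [h1.tsum_eq]⟩

/-- Contracting with `g^{μν}` adds the four ratios, three of them equal. The series is split off,
hence the argument `0` in `eomRatio`. -/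
lemma traceEquation_flrw (hI : IsOpen I) (ha : ∀ t ∈ I, 0 < a t) (hs : ContDiffOn ℝ ∞ a I)
    (f : ℕ → ℝ) {p q : ℤ} (hp : ContDiffOn ℝ ∞ (curvPowTime a k p) I)
    (hq : ContDiffOn ℝ ∞ (curvPowTime a k q) I) (G Λ : ℝ)
    (hN : NonlocalTermsDefined (flrw a k) f p q (flrwChart I k)) :
    TraceEquation (flrw a k) f p q G Λ (flrwChart I k) ↔ ∀ x ∈ flrwChart I k,
      ∃ s, HasSum (fun m => 1 / 2 * (eomRatioTerm a k f p q (x 0) 0 m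
          + 3 * eomRatioTerm a k f p q (x 0) 1 m)) s (conditional ℕ) ∧
        eomRatio a k f p q G Λ (x 0) 0 0 + 3 * eomRatio a k f p q G Λ (x 0) 0 1 + s = 0 := by
  have hΦ : ∀ y ∈ flrwChart I k, Phi (flrw a k) f p q y = PhiTime a k f p q (y 0) :=
    fun y hy => Phi_flrw hI ha hs f hp hq hy
  refine (and_iff_right hN).trans (forall₂_congr fun x hx => ?_)
  -- This is `2P - K = ½ ((P + K) + 3 (P - K))`.
  have hE : traceTerm (flrw a k) f p q x = fun m => 1 / 2 * (eomRatioTerm a k f p q (x 0) 0 m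
      + 3 * eomRatioTerm a k f p q (x 0) 1 m) := by
    ext m
    rw [traceTerm_flrw hI ha hs f hp hq hx]
    simp only [eomRatioTerm, if_true, one_ne_zero, if_false]
    ring
  rw [hE, box_time hI ha hs hΦ (contDiffOn_time hN.contDiffOn_Phi hΦ) hx, hΦ x hx,
    scalarCurv_flrw hI ha hs hx, curvPow_flrw hI ha hs _ hx,
    nonlocalOp_time hI ha hs (fun _ hy => curvPow_flrw hI ha hs q hy) hq f hx]
  -- Since `-w'' - 3 (a'/a) w' = □w`, the trace of `K_{μν}` is `□ - 4□ = -3□`.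
  have key : ∀ s, 1 / (16 * Real.pi * G) * (4 * Λ - ∑ μ, ricciRatio a k (x 0) μ)
      - 2 * curvPowTime a k p (x 0) * nonlocalOpTime a f (curvPowTime a k q) (x 0)
      + ((∑ μ, ricciRatio a k (x 0) μ) * PhiTime a k f p q (x 0)
        + 3 * boxTime a (PhiTime a k f p q) (x 0)) + s =
      eomRatio a k f p q G Λ (x 0) 0 0 + 3 * eomRatio a k f p q G Λ (x 0) 0 1 + s := fun s => by
    simp only [eomRatio, opKRatio, ricciRatio, boxTime, Fin.sum_univ_four, Matrix.cons_val]
    ring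
  rw [key]
  constructor
  · rintro ⟨h1, h2⟩
    exact ⟨_, h1.hasSum, h2⟩
  · rintro ⟨s, h1, h2⟩
    exact ⟨h1.summable, by rwa [h1.tsum_eq]⟩

lemma eomRatio_eq_add (f : ℕ → ℝ) (p q : ℤ) (G Λ t s : ℝ) (μ : Fin 4) :
    eomRatio a k f p q G Λ t s μ = eomRatio a k f p q G Λ t 0 μ + 1 / 2 * s := by
  simp only [eomRatio]; ring

end Nonlocal

end NonlocalGravity

end

/-! ### The equivalence. -/

open NonlocalGravity

theorem mainTheorem4 (I : Set ℝ) (hI : IsOpen I) (a : ℝ → ℝ) (ha : ContDiffOn ℝ ∞ a I)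
    (ha_pos : ∀ t ∈ I, 0 < a t) (k G Λ : ℝ) (hG : G ≠ 0) (f : ℕ → ℝ) (p q : ℤ)
    (hp : 0 ≤ p ∨ ∀ x ∈ NonlocalGravity.flrwChart I k,
      NonlocalGravity.scalarCurv (NonlocalGravity.flrw a k) x ≠ 0)
    (hq : 0 ≤ q ∨ ∀ x ∈ NonlocalGravity.flrwChart I k,
      NonlocalGravity.scalarCurv (NonlocalGravity.flrw a k) x ≠ 0) :
    NonlocalGravity.EOM (NonlocalGravity.flrw a k) f p q G Λ (NonlocalGravity.flrwChart I k) ↔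
      NonlocalGravity.TraceEquation (NonlocalGravity.flrw a k) f p q G Λ
          (NonlocalGravity.flrwChart I k) ∧
        NonlocalGravity.EOMComponent (NonlocalGravity.flrw a k) f p q G Λ
          (NonlocalGravity.flrwChart I k) 0 0 := by
  have hP := contDiffOn_curvPowTime hI ha_pos ha hp
  have hQ := contDiffOn_curvPowTime hI ha_pos ha hq
  constructor
  · intro h
    refine ⟨?_, h 0 0⟩
    have hN := (h 0 0).1
    rw [traceEquation_flrw hI ha_pos ha f hP hQ G Λ hN]
    intro x hx
    obtain ⟨s, hs, h0⟩ :=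
      (eomComponent_flrw_self hI ha_pos ha f hP hQ G Λ 0 hN).1 (h 0 0) x hx
    obtain ⟨s', hs', h1⟩ :=
      (eomComponent_flrw_self hI ha_pos ha f hP hQ G Λ 1 hN).1 (h 1 1) x hx
    refine ⟨_, (hs.add (hs'.mul_left 3)).mul_left (1 / 2), ?_⟩
    rw [eomRatio_eq_add] at h0 h1
    linear_combination h0 + 3 * h1
  · rintro ⟨hT, h00⟩ μ ν
    have hN := hT.1
    rcases ne_or_eq μ ν with hμν | rfl
    · exact eomComponent_flrw_of_ne hI ha_pos ha f hP hQ G Λ hμν hN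
    by_cases hμ : μ = 0
    · rwa [hμ]
    rw [eomComponent_flrw_self hI ha_pos ha f hP hQ G Λ μ hN]
    intro x hx
    obtain ⟨s, hs, h0⟩ := (eomComponent_flrw_self hI ha_pos ha f hP hQ G Λ 0 hN).1 h00 x hx
    obtain ⟨s', hs', h1⟩ := (traceEquation_flrw hI ha_pos ha f hP hQ G Λ hN).1 hT x hx
    -- The solution `s₁` of `s' = ½ (s + 3 s₁)`, where `s` and `s'` are the sums in the `00` and
    -- trace equations.
    refine ⟨1 / 3 * (2 * s' - s), ?_, ?_⟩
    · have e : eomRatioTerm a k f p q (x 0) μ = eomRatioTerm a k f p q (x 0) 1 := by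
        ext m
        simp [eomRatioTerm, hμ]
      rw [e]
      refine (((hs'.mul_left 2).sub hs).mul_left (1 / 3)).congr_fun fun m => by ring
    · rw [eomRatio_eq_of_ne_zero f p q G Λ _ _ hμ, eomRatio_eq_add]
      rw [eomRatio_eq_add] at h0
      linear_combination 1 / 3 * h1 - 1 / 3 * h0
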